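/- Let $n\ge 2$ and $\lambda>0$, and let $\Lambda$ satisfy the distortion bound $$1\le \frac{\Lambda}{\lambda}<\frac{n+1}{n-1}.$$ Let $\mathcal A(\lambda,\Lambda)$ be the set of symmetric real $n\times n$ matrices $A$ with $\lambda|\xi|^2\le \xi^\top A\,\xi\le\Lambda|\xi|^2$ for all $\xi\in\mathbb R^n$, let $A^{1/2}$ denote the principal square root, let $B_\rho$ be the open ball of radius $\rho$ centred at $0$, and let $\mathbb B=B_1$. Call $\alpha\in(0,1)$ admissible if $$\frac{\Lambda}{\lambda}<\frac{n(1-\alpha)^{1/n}+(1-\alpha)}{n-1}.$$ Let $r>0$ and $\varepsilon>0$, let $\Omega\supset B_{2r}$, let $A:\Omega\to\mathcal A(\lambda,\Lambda)$, and let $u$ be a real function that is bounded on $B_{2r}$. For $C\in\mathbb R$ and $N\in\mathbb N$ define $f=f_1-f_2$ on $\mathbb R^n\times\mathbb R^n$, where $$f_1(x,z)=C|x-z|^\alpha+\widetilde C|x+z|^2,\qquad \widetilde C=\frac{2}{3r^2}\sup_{B_{2r}}|u|,$$ $$f_2(x,z)=\begin{cases} C^{2(2N-i)}\varepsilon^\alpha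 & \text{if } \frac{i-1}{2}<\frac{|x-z|}{\sqrt\lambda\,\varepsilon}\le\frac i2\quad (i=0,1,\dots,2N),\\[4pt] 0 & \text{if } \frac{|x-z|}{\sqrt\lambda\,\varepsilon}>N.\end{cases}$$ Then every sufficiently small $\alpha>0$ (depending on $n,\lambda,\Lambda$) is admissible. Moreover, for every admissible $\alpha$ there is a constant $C_0$ depending only on $n,\lambda,\Lambda,r,\alpha$ and $\sup_{B_{2r}}|u|$, and for every $C\ge C_0$ there is $N_0\in\mathbb N$ depending only on $\lambda,\Lambda$ and $C$, such that for all $C\ge C_0$ and all $N\ge N_0$ the following holds: for all $x,z\in B_r$ with $|x-z|>\frac12\sqrt\lambda\,\varepsilon$ there is an orthogonal matrix $Q\in O(n)$ such that the integrand below is integrable on $\mathbb B$ and, with $\eta=\varepsilon^2$, $$f(x,z)>\frac{1}{|\mathbb B|}\int_{\mathbb B} f\big(x+\varepsilon A(x)^{1/2}y,\;z+\varepsilon A(z)^{1/2}Qy\big)\,dy+\eta .$$ In particular, $C_0$ and $N_0$ do not depend on $\varepsilon$. -/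

import Mathlib

open scoped MatrixOrder

noncomputable section

namespace EllipsoidProcess

/-- `ℝⁿ` with the Euclidean norm. -/
abbrev E (n : ℕ) : Type := EuclideanSpace ℝ (Fin n)

/-- The set `𝒜(lam, Lam)` of symmetric real `n × n` matrices `A` with
`lam |ξ|² ≤ ξᵀ A ξ ≤ Lam |ξ|²` for every `ξ ∈ ℝⁿ`. -/
def ellipticMatrices (n : ℕ) (lam Lam : ℝ) : Set (Matrix (Fin n) (Fin n) ℝ) :=
  {A | A.IsSymm ∧ ∀ ξ : E n,
    lam * ‖ξ‖ ^ 2 ≤ inner ℝ ξ (Matrix.toEuclideanLin A ξ) ∧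
      inner ℝ ξ (Matrix.toEuclideanLin A ξ) ≤ Lam * ‖ξ‖ ^ 2}

/-- `sup_{B_ρ} |u|`, for a function `u` that is bounded on the open ball `B_ρ` centred at `0`. -/
def supBall {n : ℕ} (u : E n → ℝ) (ρ : ℝ) : ℝ :=
  sSup ((fun x => |u x|) '' Metric.ball (0 : E n) ρ)

/-- `f₁(x, z) = C |x - z|^α + C' |x + z|²`. -/
def f₁ {n : ℕ} (C C' α : ℝ) (x z : E n) : ℝ :=
  C * ‖x - z‖ ^ α + C' * ‖x + z‖ ^ 2

/-- The annular step function: `f₂(x, z) = C^{2(2N-i)} ε^α` if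
`(i-1)/2 < |x - z| / (√lam ε) ≤ i/2` for some `i = 0, 1, …, 2N` (the conditions for different `i`
exclude each other), and `f₂(x, z) = 0` if `|x - z| / (√lam ε) > N`. -/
def f₂ {n : ℕ} (C : ℝ) (N : ℕ) (α lam ε : ℝ) (x z : E n) : ℝ :=
  open Classical in
  ∑ i ∈ Finset.range (2 * N + 1),
    if ((i : ℝ) - 1) / 2 < ‖x - z‖ / (√lam * ε) ∧ ‖x - z‖ / (√lam * ε) ≤ (i : ℝ) / 2 then
      C ^ (2 * (2 * N - i)) * ε ^ α
    else 0

/-- The comparison function `f = f₁ - f₂`, where the coefficient of `|x + z|²` in `f₁` is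
`2 / (3 r²) · sup_{B_{2r}} |u|`. -/
def comparison {n : ℕ} (C : ℝ) (N : ℕ) (α lam ε r : ℝ) (u : E n → ℝ) (x z : E n) : ℝ :=
  f₁ C (2 / (3 * r ^ 2) * supBall u (2 * r)) α x z - f₂ C N α lam ε x z

/-- `y ↦ f(x + ε A(x)^{1/2} y, z + ε A(z)^{1/2} Q y)`, with `A^{1/2}` the principal square root. -/
def coupled {n : ℕ} (f : E n → E n → ℝ) (A : E n → Matrix (Fin n) (Fin n) ℝ) (ε : ℝ)
    (x z : E n) (Q : Matrix (Fin n) (Fin n) ℝ) (y : E n) : ℝ :=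
  f (x + ε • Matrix.toEuclideanLin (CFC.sqrt (A x)) y)
    (z + ε • Matrix.toEuclideanLin (CFC.sqrt (A z) * Q) y)

/-- The smallness condition on the exponent `α`:
`Lam / lam < (n (1 - α)^{1/n} + (1 - α)) / (n - 1)`. -/
def SmallExponent (n : ℕ) (lam Lam α : ℝ) : Prop :=
  0 < α ∧ α < 1 ∧
    Lam / lam < ((n : ℝ) * (1 - α) ^ (1 / (n : ℝ)) + (1 - α)) / ((n : ℝ) - 1)

end EllipsoidProcess

end

/-! Put d = |x - z|, e = (x - z)/d and M = A(x)^{1/2} - A(z)^{1/2} Q. First-order terms are odd in y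
and average to zero. The term |x + z|² costs at most 4 Λ C̃ ε², so a gain must come from |x - z|^α
or from the step function.

If d > N √λ ε, then f₂(x, z) = 0 and the second-order term of C |x - z|^α decides. Its average is a
positive multiple of tr(Mᵀ G M) with G = I - (2 - α) e ⊗ e. The trace is tr(G A(x)) + tr(G A(z)) - 2
tr(Qᵀ X), where X = A(z)^{1/2} G A(x)^{1/2}. Taking Q to be the polar factor of X turns the last
trace into tr √(XᵀX) ≥ n |det X|^{1/n} ≥ n (1 - α)^{1/n} λ, while each of the others is at most (n -
1) Λ - (1 - α) λ. Admissibility of α says exactly that the resulting bound is negative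
(`exists_orthogonal_trace_hessian_le`). Since N ≥ C, the ratio ε/d is small enough to absorb the
Taylor remainder (`exists_average_lt_of_far`).

If d ≤ N √λ ε, another Q makes some y pull the two points towards each other. On a ball of such y,
filling a fixed fraction of 𝔹, the annulus index drops and f₂ grows by the factor C². This beats the
growth of f₁, which is only linear in C (`exists_average_lt_of_near`). -/

namespace EllipsoidProcess

/-! ### Scalar Taylor bound -/

/-- A third-order upper bound for `(1 + s) ^ b` near `s = 0`. -/
theorem one_add_rpow_le_taylor {b s : ℝ} (hb0 : 0 < b) (hb1 : b ≤ 1 / 2) (hs : |s| ≤ 1 / 2) :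
    (1 + s) ^ b ≤ 1 + b * s - b * (1 - b) / 2 * s ^ 2 + 10 * |s| ^ 3 := by
  have hs' := abs_le.1 hs
  have hpos : 0 < 1 + s := by linarith
  -- In (1 + s)^b = exp(b log(1 + s)), the logarithm and then the exponential are expanded to second
  -- order; all errors go into |s|³.
  have hlog := Real.abs_log_sub_add_sum_range_le (x := -s) (by rw [abs_neg]; linarith) 2
  simp only [Finset.sum_range_succ, Finset.sum_range_zero, abs_neg, sub_neg_eq_add] at hlog
  norm_num at hlog
  have h2 : |s| ^ 3 / (1 - |s|) ≤ 2 * |s| ^ 3 := by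
    rw [div_le_iff₀ (by linarith)]
    have : 0 ≤ |s| ^ 3 := by positivity
    nlinarith
  obtain ⟨l1, l2⟩ := abs_le.1 (hlog.trans h2)
  set ℓ := Real.log (1 + s)
  set a := |s| with ha
  have ha0 : 0 ≤ a := abs_nonneg s
  have ha2 : a ^ 2 = s ^ 2 := sq_abs s
  have hd : |ℓ - s| ≤ 3 / 2 * a ^ 2 := by
    rw [abs_le]
    constructor <;> nlinarith [pow_le_pow_left₀ ha0 hs 2]
  have hla : |ℓ| ≤ 7 / 4 * a := by
    have : |ℓ| ≤ |ℓ - s| + |s| := by simpa using abs_add_le (ℓ - s) s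
    nlinarith
  have ht1 : |ℓ * b| ≤ 7 / 8 * a := by
    rw [abs_mul, abs_of_pos hb0]
    nlinarith [abs_nonneg ℓ]
  have hexp := Real.exp_bound (x := ℓ * b) (by linarith) (n := 3) (by norm_num)
  simp only [Finset.sum_range_succ, Finset.sum_range_zero] at hexp
  norm_num [Nat.factorial] at hexp
  have ht3 : |ℓ * b| ^ 3 ≤ a ^ 3 := pow_le_pow_left₀ (abs_nonneg _) (by linarith) 3
  rw [← abs_mul] at hexp
  have he := (abs_le.1 hexp).2
  have hsq : ℓ ^ 2 ≤ s ^ 2 + 5 * a ^ 3 := by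
    have h1 : ℓ ^ 2 = s ^ 2 + (ℓ - s) * (ℓ + s) := by ring
    have h3 : (ℓ - s) * (ℓ + s) ≤ |ℓ - s| * |ℓ + s| := by rw [← abs_mul]; exact le_abs_self _
    have h4 : |ℓ + s| ≤ 11 / 4 * a := (abs_add_le _ _).trans (by linarith)
    have h5 : |ℓ - s| * |ℓ + s| ≤ 3 / 2 * a ^ 2 * (11 / 4 * a) := by gcongr
    nlinarith [pow_nonneg ha0 3]
  rw [Real.rpow_def_of_pos hpos]
  have ha3 : 0 ≤ a ^ 3 := by positivity
  have e1 : b * ℓ ≤ b * (s - s ^ 2 / 2 + 2 * a ^ 3) := by gcongr; linarith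
  have e2 : b ^ 2 * ℓ ^ 2 ≤ b ^ 2 * (s ^ 2 + 5 * a ^ 3) := by gcongr
  have e3 : b * a ^ 3 ≤ 1 / 2 * a ^ 3 := by gcongr
  have e4 : b ^ 2 * a ^ 3 ≤ (1 / 2) ^ 2 * a ^ 3 := by gcongr
  nlinarith

/-! ### Trace estimates and the optimal orthogonal coupling -/

open Matrix

variable {n : ℕ}

/-- The arithmetic-geometric mean inequality for the eigenvalues. -/
theorem card_mul_det_rpow_le_trace (hn : 0 < n) {P : Matrix (Fin n) (Fin n) ℝ}
    (hP : P.PosSemidef) : n * P.det ^ (1 / (n : ℝ)) ≤ P.trace := by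
  have hn' : (0 : ℝ) < n := by exact_mod_cast hn
  have h := Real.geom_mean_le_arith_mean_weighted Finset.univ (fun _ : Fin n => 1 / (n : ℝ))
    hP.1.eigenvalues (fun _ _ => by positivity) (by simp [hn'.ne'])
    (fun i _ => hP.eigenvalues_nonneg i)
  rw [hP.1.det_eq_prod_eigenvalues, hP.1.trace_eq_sum_eigenvalues]
  simp only [RCLike.ofReal_real_eq_id, id]
  rw [← Real.finsetProd_rpow _ _ (fun i _ => hP.eigenvalues_nonneg i)]
  rw [← Finset.mul_sum, one_div, ← div_eq_inv_mul, le_div_iff₀ hn'] at h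
  rw [one_div]
  linarith

/-- The orthogonal polar factor of an invertible matrix. -/
theorem exists_orthogonal_trace_ge (hn : 0 < n) {X : Matrix (Fin n) (Fin n) ℝ}
    (hX : X.det ≠ 0) : ∃ Q ∈ orthogonalGroup (Fin n) ℝ,
      n * |X.det| ^ (1 / (n : ℝ)) ≤ (Qᵀ * X).trace := by
  have hXX : (0 : Matrix (Fin n) (Fin n) ℝ) ≤ Xᵀ * X := by
    rw [nonneg_iff_posSemidef]
    simpa using posSemidef_conjTranspose_mul_self X
  set P := CFC.sqrt (Xᵀ * X)
  have hP : P.PosSemidef := nonneg_iff_posSemidef.1 (CFC.sqrt_nonneg _)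
  have hPP : P * P = Xᵀ * X := CFC.sqrt_mul_sqrt_self _ hXX
  have hPt : Pᵀ = P := by simpa [IsHermitian] using hP.1
  have hdet : P.det = |X.det| := by
    have h1 : P.det ^ 2 = X.det ^ 2 := by
      have := congrArg det hPP
      rw [det_mul, det_mul, det_transpose] at this
      rw [sq, sq, this]
    rw [← abs_of_nonneg hP.det_nonneg]
    exact (sq_eq_sq_iff_abs_eq_abs _ _).1 h1
  have hu : IsUnit P.det := by rw [hdet]; simpa using hX
  have hQt : (X * P⁻¹)ᵀ = P⁻¹ * Xᵀ := by
    rw [transpose_mul, transpose_nonsing_inv, hPt]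
  -- Here Qᵀ X = P⁻¹ P² = P, and det P = |det X|.
  refine ⟨X * P⁻¹, ?_, ?_⟩
  · rw [mem_orthogonalGroup_iff', hQt]
    calc P⁻¹ * Xᵀ * (X * P⁻¹) = P⁻¹ * (Xᵀ * X) * P⁻¹ := by simp only [Matrix.mul_assoc]
      _ = 1 := by
        rw [← hPP, ← Matrix.mul_assoc, nonsing_inv_mul _ hu, Matrix.one_mul, mul_nonsing_inv _ hu]
  · rw [hQt, Matrix.mul_assoc, ← hPP, ← Matrix.mul_assoc, nonsing_inv_mul _ hu, Matrix.one_mul,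
      ← hdet]
    exact card_mul_det_rpow_le_trace hn hP

/-- With P = S² and S symmetric, the form is |S e|² and the trace is the squared Frobenius norm of
S, so Cauchy–Schwarz on each row suffices. -/
theorem dotProduct_mulVec_le_trace {P : Matrix (Fin n) (Fin n) ℝ} (hP : P.PosSemidef)
    {e : Fin n → ℝ} (he : e ⬝ᵥ e = 1) : e ⬝ᵥ P *ᵥ e ≤ P.trace := by
  set S := CFC.sqrt P
  have hS : S.PosSemidef := nonneg_iff_posSemidef.1 (CFC.sqrt_nonneg _)
  have hSS : S * S = P := CFC.sqrt_mul_sqrt_self _ (nonneg_iff_posSemidef.2 hP)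
  have hSt : Sᵀ = S := by simpa [IsHermitian] using hS.1
  have h1 : e ⬝ᵥ P *ᵥ e = (S *ᵥ e) ⬝ᵥ (S *ᵥ e) := by
    rw [← hSS, ← mulVec_mulVec, dotProduct_mulVec, ← mulVec_transpose, hSt]
  have h2 : P.trace = ∑ i, ∑ j, S i j ^ 2 := by
    rw [← hSS]
    nth_rewrite 2 [← hSt]
    simp [trace, mul_apply, sq]
  rw [h1, h2, dotProduct]
  refine Finset.sum_le_sum fun i _ => ?_
  have := Finset.sum_mul_sq_le_sq_mul_sq Finset.univ (S i) e
  have he' : ∑ j, e j ^ 2 = 1 := by simpa [dotProduct, sq] using he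
  rw [he', mul_one] at this
  simpa [mulVec, dotProduct, sq] using this

section Elliptic

variable {lam Lam : ℝ} {A B : Matrix (Fin n) (Fin n) ℝ}

theorem inner_toEuclideanLin (M : Matrix (Fin n) (Fin n) ℝ) (v w : E n) :
    inner ℝ v (toEuclideanLin M w) = v.ofLp ⬝ᵥ M *ᵥ w.ofLp := by
  rw [EuclideanSpace.inner_eq_star_dotProduct, dotProduct_comm]
  simp [toEuclideanLin]

theorem ellipticMatrices.posSemidef (hl : 0 ≤ lam) (hA : A ∈ ellipticMatrices n lam Lam) :
    A.PosSemidef := by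
  refine .of_dotProduct_mulVec_nonneg (by simpa [IsHermitian] using hA.1.eq) fun v => ?_
  have := (hA.2 (WithLp.toLp 2 v)).1
  rw [inner_toEuclideanLin] at this
  exact le_trans (by positivity) this

theorem ellipticMatrices.sqrt_mul_sqrt (hl : 0 ≤ lam) (hA : A ∈ ellipticMatrices n lam Lam) :
    CFC.sqrt A * CFC.sqrt A = A :=
  CFC.sqrt_mul_sqrt_self _ (nonneg_iff_posSemidef.2 (ellipticMatrices.posSemidef hl hA))

theorem transpose_sqrt (A : Matrix (Fin n) (Fin n) ℝ) : (CFC.sqrt A)ᵀ = CFC.sqrt A := by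
  simpa [IsHermitian] using (nonneg_iff_posSemidef.1 (CFC.sqrt_nonneg A)).1

theorem norm_sq_toEuclideanLin_sqrt (hl : 0 ≤ lam) (hA : A ∈ ellipticMatrices n lam Lam)
    (y : E n) :
    ‖toEuclideanLin (CFC.sqrt A) y‖ ^ 2 = inner ℝ y (toEuclideanLin A y) := by
  rw [inner_toEuclideanLin, ← real_inner_self_eq_norm_sq, inner_toEuclideanLin,
    ← ellipticMatrices.sqrt_mul_sqrt hl hA, ← mulVec_mulVec,
    dotProduct_mulVec y.ofLp, ← mulVec_transpose, transpose_sqrt,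
    ellipticMatrices.sqrt_mul_sqrt hl hA]
  simp [toEuclideanLin]

theorem norm_toEuclideanLin_sqrt_le (hl : 0 ≤ lam) (hA : A ∈ ellipticMatrices n lam Lam)
    (y : E n) : ‖toEuclideanLin (CFC.sqrt A) y‖ ≤ √Lam * ‖y‖ := by
  have h := (hA.2 y).2
  rw [← norm_sq_toEuclideanLin_sqrt hl hA] at h
  have := Real.sqrt_le_sqrt h
  rwa [Real.sqrt_sq (norm_nonneg _), Real.sqrt_mul' _ (by positivity),
    Real.sqrt_sq (norm_nonneg _)] at this

theorem le_norm_toEuclideanLin_sqrt (hl : 0 ≤ lam) (hA : A ∈ ellipticMatrices n lam Lam)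
    (y : E n) : √lam * ‖y‖ ≤ ‖toEuclideanLin (CFC.sqrt A) y‖ := by
  have h := (hA.2 y).1
  rw [← norm_sq_toEuclideanLin_sqrt hl hA] at h
  have := Real.sqrt_le_sqrt h
  rwa [Real.sqrt_sq (norm_nonneg _), Real.sqrt_mul' _ (by positivity),
    Real.sqrt_sq (norm_nonneg _)] at this

theorem ellipticMatrices.pow_le_det (hl : 0 ≤ lam) (hA : A ∈ ellipticMatrices n lam Lam) :
    lam ^ n ≤ A.det := by
  have hP := ellipticMatrices.posSemidef hl hA
  rw [hP.1.det_eq_prod_eigenvalues]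
  simp only [RCLike.ofReal_real_eq_id, id]
  have : lam ^ n = ∏ _i : Fin n, lam := by simp
  rw [this]
  refine Finset.prod_le_prod (fun _ _ => hl) fun i _ => ?_
  set v := hP.1.eigenvectorBasis i with hv
  have h := (hA.2 v).1
  have hv1 : ‖v‖ = 1 := hP.1.eigenvectorBasis.orthonormal.1 i
  rw [inner_toEuclideanLin, hv, hP.1.mulVec_eigenvectorBasis i, dotProduct_smul, ← hv] at h
  have h2 : v.ofLp ⬝ᵥ v.ofLp = 1 := by
    have := real_inner_self_eq_norm_sq v
    rw [hv1, EuclideanSpace.inner_eq_star_dotProduct] at this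
    simpa using this
  rw [h2, hv1] at h
  simpa using h

/-- Applying `dotProduct_mulVec_le_trace` to Λ I - A gives tr A - eᵀ A e ≤ (n - 1) Λ; the remaining
-(1 - α) eᵀ A e is at most -(1 - α) λ. -/
theorem ellipticMatrices.trace_le (hA : A ∈ ellipticMatrices n lam Lam)
    {α : ℝ} (hα : α ≤ 1) {e : Fin n → ℝ} (he : e ⬝ᵥ e = 1) :
    A.trace - (2 - α) * (e ⬝ᵥ A *ᵥ e) ≤ (n - 1) * Lam - (1 - α) * lam := by
  have hP : (Lam • (1 : Matrix (Fin n) (Fin n) ℝ) - A).PosSemidef := by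
    refine .of_dotProduct_mulVec_nonneg ?_ fun v => ?_
    · have := hA.1
      simp [IsHermitian, this.eq]
    · have := (hA.2 (WithLp.toLp 2 v)).2
      rw [inner_toEuclideanLin, ← real_inner_self_eq_norm_sq,
        EuclideanSpace.inner_eq_star_dotProduct] at this
      simpa [sub_mulVec, smul_mulVec] using this
  have h1 := dotProduct_mulVec_le_trace hP he
  have h2 := (hA.2 (WithLp.toLp 2 e)).1
  rw [inner_toEuclideanLin, ← real_inner_self_eq_norm_sq,
    EuclideanSpace.inner_eq_star_dotProduct] at h2
  simp [sub_mulVec, smul_mulVec, he] at h1 h2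
  nlinarith

/-- The matrix `I - (2 - α) e ⊗ e`, which is `α⁻¹` times the Hessian of `|·|^α` at a unit
vector `e`. -/
def hessian (α : ℝ) (e : Fin n → ℝ) : Matrix (Fin n) (Fin n) ℝ :=
  1 - (2 - α) • vecMulVec e e

theorem hessian_transpose (α : ℝ) (e : Fin n → ℝ) : (hessian α e)ᵀ = hessian α e := by
  simp [hessian, transpose_vecMulVec]

theorem hessian_det (α : ℝ) {e : Fin n → ℝ} (he : e ⬝ᵥ e = 1) : (hessian α e).det = α - 1 := by
  have h := det_one_add_replicateCol_mul_replicateRow (ι := Unit) ((α - 2) • e) e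
  have h2 : hessian α e = 1 + replicateCol Unit ((α - 2) • e) * replicateRow Unit e := by
    ext i j
    simp [hessian, vecMulVec_apply, mul_apply]
    ring
  rw [h2, h, dotProduct_smul, he]
  simp
  ring

theorem dotProduct_hessian_mulVec (α : ℝ) (e v : Fin n → ℝ) :
    v ⬝ᵥ hessian α e *ᵥ v = v ⬝ᵥ v - (2 - α) * (e ⬝ᵥ v) ^ 2 := by
  simp only [hessian, sub_mulVec, smul_mulVec, vecMulVec_mulVec, dotProduct_smul,
    dotProduct_comm v e, one_mulVec, dotProduct_sub, MulOpposite.smul_eq_mul_unop, smul_eq_mul,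
    MulOpposite.unop_op]
  ring

theorem trace_hessian_mul (α : ℝ) (e : Fin n → ℝ) (A : Matrix (Fin n) (Fin n) ℝ) :
    (hessian α e * A).trace = A.trace - (2 - α) * (e ⬝ᵥ A *ᵥ e) := by
  rw [hessian, Matrix.sub_mul, Matrix.one_mul, trace_sub, Matrix.smul_mul, trace_smul,
    vecMulVec_mul, trace_vecMulVec, dotProduct_comm, ← dotProduct_mulVec, smul_eq_mul]

/-- The optimal coupling matrix makes the trace of the second-order term negative. -/
theorem exists_orthogonal_trace_hessian_le (hn : 0 < n) (hl : 0 < lam)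
    (hA : A ∈ ellipticMatrices n lam Lam) (hB : B ∈ ellipticMatrices n lam Lam)
    {α : ℝ} (hα : α < 1) {e : Fin n → ℝ} (he : e ⬝ᵥ e = 1) :
    ∃ Q ∈ orthogonalGroup (Fin n) ℝ,
      ((CFC.sqrt A - CFC.sqrt B * Q)ᵀ * hessian α e * (CFC.sqrt A - CFC.sqrt B * Q)).trace ≤
        2 * ((n - 1) * Lam - (1 - α) * lam) - 2 * (n * (1 - α) ^ (1 / (n : ℝ)) * lam) := by
  set S := CFC.sqrt A
  set R := CFC.sqrt B
  set G := hessian α e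
  have hSt : Sᵀ = S := transpose_sqrt A
  have hRt : Rᵀ = R := transpose_sqrt B
  have hGt : Gᵀ = G := hessian_transpose α e
  have hSS : S * S = A := ellipticMatrices.sqrt_mul_sqrt hl.le hA
  have hRR : R * R = B := ellipticMatrices.sqrt_mul_sqrt hl.le hB
  -- Squaring replaces the determinants of the square roots by det A and det B, and removes the
  -- negative sign of det G.
  have hdet : (1 - α) * lam ^ n ≤ |(R * G * S).det| := by
    have h1 : (R * G * S).det ^ 2 = A.det * B.det * (1 - α) ^ 2 := by
      rw [← hSS, ← hRR]
      simp only [det_mul, G, hessian_det α he]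
      ring
    refine abs_le_of_sq_le_sq' ?_ (abs_nonneg _) |>.2
    rw [sq_abs]
    rw [h1]
    have hA' := ellipticMatrices.pow_le_det hl.le hA
    have hB' := ellipticMatrices.pow_le_det hl.le hB
    have := mul_le_mul hA' hB' (by positivity) (le_trans (by positivity) hA')
    nlinarith [sq_nonneg (1 - α)]
  have hpos : 0 < (1 - α) * lam ^ n := mul_pos (by linarith) (by positivity)
  obtain ⟨Q, hQ, hQX⟩ := exists_orthogonal_trace_ge hn (X := R * G * S)
    (abs_pos.1 (hpos.trans_le hdet))
  refine ⟨Q, hQ, ?_⟩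
  have hQQ : Q * Qᵀ = 1 := (mem_orthogonalGroup_iff _ _).1 hQ
  have hn' : (0 : ℝ) < n := by exact_mod_cast hn
  have hroot : n * (1 - α) ^ (1 / (n : ℝ)) * lam ≤ (Qᵀ * (R * G * S)).trace := by
    refine le_trans ?_ hQX
    have h3 : (1 - α) ^ (1 / (n : ℝ)) * lam = ((1 - α) * lam ^ n) ^ (1 / (n : ℝ)) := by
      rw [Real.mul_rpow (by linarith) (by positivity), one_div,
        Real.pow_rpow_inv_natCast hl.le hn.ne']
    rw [mul_assoc, h3]
    gcongr
  -- The two cross terms are transposes of each other, and orthogonality removes Q from the last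
  -- term.
  have hcross : (S * G * R * Q).trace = (Qᵀ * (R * G * S)).trace := by
    rw [← trace_transpose]
    simp only [transpose_mul, hSt, hRt, hGt, Matrix.mul_assoc]
  have hcross' : (Qᵀ * R * G * S).trace = (Qᵀ * (R * G * S)).trace := by
    simp only [Matrix.mul_assoc]
  have hRQ : (Qᵀ * R * G * R * Q).trace = (G * B).trace := by
    rw [trace_mul_comm]
    have : Q * (Qᵀ * R * G * R) = R * G * R := by
      rw [Matrix.mul_assoc, Matrix.mul_assoc, ← Matrix.mul_assoc, hQQ, Matrix.one_mul,
        Matrix.mul_assoc]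
    rw [this, Matrix.mul_assoc, trace_mul_comm, Matrix.mul_assoc, hRR]
  have hSS' : (S * G * S).trace = (G * A).trace := by
    rw [Matrix.mul_assoc, trace_mul_comm, Matrix.mul_assoc, hSS]
  have hexp : (S - R * Q)ᵀ * G * (S - R * Q) =
      S * G * S - S * G * R * Q - Qᵀ * R * G * S + Qᵀ * R * G * R * Q := by
    rw [transpose_sub, transpose_mul, hSt, hRt]
    noncomm_ring
  rw [hexp, trace_add, trace_sub, trace_sub, hcross, hcross', hRQ, hSS', trace_hessian_mul,
    trace_hessian_mul]
  have t1 := ellipticMatrices.trace_le hA hα.le he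
  have t2 := ellipticMatrices.trace_le hB hα.le he
  linarith

end Elliptic

end EllipsoidProcess

/-! ### Moments of the unit ball by symmetry -/

namespace EllipsoidProcess

open MeasureTheory Metric

variable {n : ℕ}

theorem setIntegral_ball_comp (g : E n ≃ₗᵢ[ℝ] E n) (f : E n → ℝ) :
    ∫ y in ball (0 : E n) 1, f (g y) = ∫ y in ball (0 : E n) 1, f y := by
  have h := g.measurePreserving.setIntegral_preimage_emb
    g.toHomeomorph.measurableEmbedding f (ball 0 1)
  rw [← h]
  congr 2
  ext y
  simp

theorem setIntegral_ball_odd {f : E n → ℝ} (hf : ∀ y, f (-y) = -f y) :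
    ∫ y in ball (0 : E n) 1, f y = 0 := by
  have h := setIntegral_ball_comp (LinearIsometryEquiv.neg ℝ) f
  simp only [LinearIsometryEquiv.coe_neg, hf, integral_neg] at h
  linarith

theorem integrableOn_ball_of_continuous {f : E n → ℝ} (hf : Continuous f) :
    IntegrableOn f (ball 0 1) :=
  (hf.continuousOn.integrableOn_compact (isCompact_closedBall 0 1)).mono_set ball_subset_closedBall

/-- The second moment of a coordinate on the unit ball. -/
noncomputable def secondMoment (n : ℕ) : ℝ := (∫ y in ball (0 : E n) 1, ‖y‖ ^ 2) / n

theorem setIntegral_ball_mul_of_ne {i j : Fin n} (hij : i ≠ j) :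
    ∫ y in ball (0 : E n) 1, y i * y j = 0 := by
  classical
  let g : E n ≃ₗᵢ[ℝ] E n := LinearIsometryEquiv.piLpCongrRight 2
    (fun k => if k = i then LinearIsometryEquiv.neg ℝ else LinearIsometryEquiv.refl ℝ ℝ)
  have h := setIntegral_ball_comp g (fun y => y i * y j)
  have h1 : ∀ y, g y i = - y i := fun y => by simp [g]
  have h2 : ∀ y, g y j = y j := fun y => by simp [g, hij.symm]
  simp only [h1, h2, neg_mul, integral_neg] at h
  linarith

theorem setIntegral_ball_sq (i : Fin n) :
    ∫ y in ball (0 : E n) 1, y i * y i = secondMoment n := by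
  have hperm : ∀ j : Fin n, ∫ y in ball (0 : E n) 1, y j * y j =
      ∫ y in ball (0 : E n) 1, y i * y i := by
    intro j
    let g : E n ≃ₗᵢ[ℝ] E n := LinearIsometryEquiv.piLpCongrLeft 2 ℝ ℝ (Equiv.swap i j)
    have h := setIntegral_ball_comp g (fun y => y i * y i)
    have h1 : ∀ y, g y i = y j := fun y => by
      simp [g, LinearIsometryEquiv.piLpCongrLeft_apply, Equiv.piCongrLeft'_apply]
    simpa only [h1] using h
  have hn : (n : ℝ) ≠ 0 := by
    have := i.pos
    positivity
  rw [secondMoment, eq_div_iff hn]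
  have : ∀ y : E n, ‖y‖ ^ 2 = ∑ j, y j * y j := fun y => by
    rw [EuclideanSpace.norm_sq_eq]
    simp [sq]
  simp only [this]
  rw [integral_finsetSum _ fun j _ => integrableOn_ball_of_continuous (by fun_prop)]
  simp [hperm, mul_comm]

theorem secondMoment_pos (hn : 0 < n) : 0 < secondMoment n := by
  have hn' : (0 : ℝ) < n := by exact_mod_cast hn
  refine div_pos ?_ hn'
  have : Nonempty (Fin n) := ⟨⟨0, hn⟩⟩
  rw [setIntegral_pos_iff_support_of_nonneg_ae (Filter.Eventually.of_forall fun y => by positivity)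
    (integrableOn_ball_of_continuous (by fun_prop))]
  have h1 : Function.support (fun y : E n => ‖y‖ ^ 2) ∩ ball 0 1 = ball 0 1 \ {0} := by
    ext y
    simp [and_comm]
  rw [h1, measure_sdiff_null (by simp)]
  exact measure_ball_pos _ _ one_pos

-- Coordinate reflections kill the mixed moments and coordinate swaps equate the pure ones, so only
-- the trace survives.
open Matrix in
theorem setIntegral_ball_quadratic (S : Matrix (Fin n) (Fin n) ℝ) :
    ∫ y in ball (0 : E n) 1, y.ofLp ⬝ᵥ S *ᵥ y.ofLp = secondMoment n * S.trace := by
  have h1 : ∀ y : E n, y.ofLp ⬝ᵥ S *ᵥ y.ofLp = ∑ i, ∑ j, S i j * (y i * y j) := fun y => by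
    simp only [dotProduct, mulVec, Finset.mul_sum]
    exact Finset.sum_congr rfl fun i _ => Finset.sum_congr rfl fun j _ => by ring
  simp only [h1]
  rw [integral_finsetSum _ fun i _ => integrableOn_ball_of_continuous (by fun_prop)]
  have h2 : ∀ i : Fin n, ∫ y in ball (0 : E n) 1, ∑ j, S i j * (y i * y j) =
      secondMoment n * S i i := by
    intro i
    rw [integral_finsetSum _ fun j _ => integrableOn_ball_of_continuous (by fun_prop)]
    rw [Finset.sum_eq_single i]
    · rw [integral_const_mul, setIntegral_ball_sq, mul_comm]
    · intro j _ hj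
      rw [integral_const_mul, setIntegral_ball_mul_of_ne hj.symm, mul_zero]
    · simp
  simp only [h2, ← Finset.mul_sum]
  rfl

end EllipsoidProcess

/-! ### The annular step function and integrability -/

namespace EllipsoidProcess

open MeasureTheory Metric

variable {n : ℕ}

/-- The annulus index is a natural-number ceiling, which collapses the sum defining `f₂` to one
term. The index i = 0 occurs only for t = 0. -/
theorem mem_annulus_iff {t : ℝ} (ht : 0 ≤ t) (i : ℕ) :
    (((i : ℝ) - 1) / 2 < t ∧ t ≤ (i : ℝ) / 2) ↔ i = ⌈2 * t⌉₊ := by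
  rcases Nat.eq_zero_or_pos i with rfl | hi
  · rw [eq_comm, Nat.ceil_eq_zero]
    constructor
    · rintro ⟨-, h⟩
      norm_num at h
      linarith
    · intro h
      constructor <;> norm_num <;> linarith
  · rw [eq_comm, Nat.ceil_eq_iff hi.ne']
    have : ((i - 1 : ℕ) : ℝ) = i - 1 := by
      push_cast [Nat.one_le_iff_ne_zero.2 hi.ne']
      ring
    rw [this]
    constructor <;> rintro ⟨h1, h2⟩ <;> constructor <;> linarith

theorem f₂_eq {C α lam ε : ℝ} (hε : 0 ≤ ε) (N : ℕ) (x z : E n) :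
    f₂ C N α lam ε x z =
      if ⌈2 * (‖x - z‖ / (√lam * ε))⌉₊ ≤ 2 * N then
        C ^ (2 * (2 * N - ⌈2 * (‖x - z‖ / (√lam * ε))⌉₊)) * ε ^ α
      else 0 := by
  have ht : 0 ≤ ‖x - z‖ / (√lam * ε) := by positivity
  simp only [f₂, mem_annulus_iff ht, Finset.sum_ite_eq', Finset.mem_range, Nat.lt_succ_iff]

theorem f₂_nonneg {C α lam ε : ℝ} (hε : 0 ≤ ε) (N : ℕ) (x z : E n) :
    0 ≤ f₂ C N α lam ε x z := by
  rw [f₂_eq hε]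
  split_ifs
  · rw [pow_mul]
    positivity
  · exact le_rfl

theorem f₂_le {C α lam ε : ℝ} (hC : 1 ≤ C) (hε : 0 ≤ ε) (N : ℕ) (x z : E n) :
    f₂ C N α lam ε x z ≤ C ^ (4 * N) * ε ^ α := by
  rw [f₂_eq hε]
  split_ifs
  · exact mul_le_mul_of_nonneg_right (pow_le_pow_right₀ hC (by omega)) (by positivity)
  · positivity

theorem measurable_f₂ {C α lam ε : ℝ} (hε : 0 ≤ ε) (N : ℕ) :
    Measurable fun p : E n × E n => f₂ C N α lam ε p.1 p.2 := by
  have h1 : Measurable fun p : E n × E n => ⌈2 * (‖p.1 - p.2‖ / (√lam * ε))⌉₊ :=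
    Nat.measurable_ceil.comp (by fun_prop)
  have h2 : Measurable fun k : ℕ => if k ≤ 2 * N then C ^ (2 * (2 * N - k)) * ε ^ α else 0 :=
    measurable_from_top
  simp only [f₂_eq hε]
  exact h2.comp h1

theorem continuous_f₁ {α : ℝ} (hα : 0 ≤ α) (C C' : ℝ) :
    Continuous fun p : E n × E n => f₁ C C' α p.1 p.2 := by
  unfold f₁
  have : Continuous fun p : E n × E n => ‖p.1 - p.2‖ ^ α :=
    Continuous.rpow_const (by fun_prop) fun _ => Or.inr hα
  fun_prop

theorem continuous_coupling (A : E n → Matrix (Fin n) (Fin n) ℝ) (ε : ℝ) (x z : E n)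
    (Q : Matrix (Fin n) (Fin n) ℝ) :
    Continuous fun y : E n => (x + ε • Matrix.toEuclideanLin (CFC.sqrt (A x)) y,
      z + ε • Matrix.toEuclideanLin (CFC.sqrt (A z) * Q) y) := by
  have h1 := LinearMap.continuous_of_finiteDimensional (Matrix.toEuclideanLin (CFC.sqrt (A x)))
  have h2 := LinearMap.continuous_of_finiteDimensional (Matrix.toEuclideanLin (CFC.sqrt (A z) * Q))
  fun_prop

theorem integrableOn_coupled {C α lam ε r : ℝ} (hC : 1 ≤ C) (hα : 0 ≤ α) (hε : 0 ≤ ε) (N : ℕ)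
    (u : E n → ℝ) (A : E n → Matrix (Fin n) (Fin n) ℝ) (x z : E n)
    (Q : Matrix (Fin n) (Fin n) ℝ) :
    IntegrableOn (coupled (comparison C N α lam ε r u) A ε x z Q) (ball 0 1) := by
  have hc := continuous_coupling A ε x z Q
  have h1 := integrableOn_ball_of_continuous
    ((continuous_f₁ hα C (2 / (3 * r ^ 2) * supBall u (2 * r))).comp hc)
  refine h1.sub ?_
  refine Measure.integrableOn_of_bounded (M := C ^ (4 * N) * ε ^ α) measure_ball_lt_top.ne
    ((measurable_f₂ hε N).comp hc.measurable).aestronglyMeasurable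
    (Filter.Eventually.of_forall fun y => ?_)
  rw [Real.norm_of_nonneg (f₂_nonneg hε N _ _)]
  exact f₂_le hC hε N _ _

end EllipsoidProcess

/-! ### Local expansion and displacement estimates -/

namespace EllipsoidProcess

open MeasureTheory Metric Matrix

variable {n : ℕ} {lam Lam : ℝ} {A B : Matrix (Fin n) (Fin n) ℝ}

/-- With h = ε/|v| and p the component of w along v, |v + ε w|² = |v|² (1 + s) for s = 2hp + h²|w|²,
and `one_add_rpow_le_taylor` applies with exponent α/2. -/
theorem norm_add_smul_rpow_le {α m ε : ℝ} (hα0 : 0 < α) (hα1 : α < 1) {v w : E n} (hv : v ≠ 0)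
    (hε : 0 < ε) (hw : ‖w‖ ≤ m) (hm : 6 * (ε * m) ≤ ‖v‖) :
    ‖v + ε • w‖ ^ α ≤ ‖v‖ ^ α * (1 + α * (ε / ‖v‖) * (inner ℝ v w / ‖v‖) +
      α / 2 * (ε / ‖v‖) ^ 2 * (‖w‖ ^ 2 - (2 - α) * (inner ℝ v w / ‖v‖) ^ 2) +
      110 * (ε / ‖v‖) ^ 3 * m ^ 3) := by
  set d := ‖v‖ with hd
  have hd0 : 0 < d := norm_pos_iff.2 hv
  have hm0 : 0 ≤ m := (norm_nonneg w).trans hw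
  set h := ε / d with hh
  have hh0 : 0 < h := div_pos hε hd0
  set p := inner ℝ v w / d with hp
  have hhm : h * m ≤ 1 / 6 := by
    rw [hh, div_mul_eq_mul_div, div_le_iff₀ hd0]
    linarith
  have hpm : |p| ≤ m := by
    rw [hp, abs_div, abs_of_pos hd0, div_le_iff₀ hd0]
    have := abs_real_inner_le_norm v w
    nlinarith
  set s := 2 * h * p + h ^ 2 * ‖w‖ ^ 2 with hs
  have hsq : ‖v + ε • w‖ ^ 2 = d ^ 2 * (1 + s) := by
    rw [norm_add_sq_real, inner_smul_right, norm_smul, Real.norm_of_nonneg hε.le, hs, hh, hp, ← hd]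
    field_simp
    ring
  have hww : ‖w‖ ^ 2 ≤ m ^ 2 := pow_le_pow_left₀ (norm_nonneg _) hw 2
  have hx0 : 0 ≤ h * m := by positivity
  -- The constant is 2 + 1/6, from h m ≤ 1/6. The final 110 then covers 10 (13/6)³ + 4.
  have hsabs : |s| ≤ 13 / 6 * (h * m) := by
    have h1 : |s| ≤ |2 * h * p| + |h ^ 2 * ‖w‖ ^ 2| := abs_add_le _ _
    rw [abs_mul, abs_of_pos (by positivity : 0 < 2 * h),
      abs_of_nonneg (by positivity : 0 ≤ h ^ 2 * ‖w‖ ^ 2)] at h1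
    have h2 : 2 * h * |p| ≤ 2 * h * m := by gcongr
    have h3 : h ^ 2 * ‖w‖ ^ 2 ≤ h ^ 2 * m ^ 2 := by gcongr
    nlinarith
  have ht := one_add_rpow_le_taylor (b := α / 2) (s := s) (by linarith) (by linarith) (by linarith)
  have hs3 : |s| ^ 3 ≤ (13 / 6 * (h * m)) ^ 3 := pow_le_pow_left₀ (abs_nonneg _) hsabs 3
  have hs2 : 4 * h ^ 2 * p ^ 2 - 4 * (h * m) ^ 3 ≤ s ^ 2 := by
    have h1 : s ^ 2 = 4 * h ^ 2 * p ^ 2 + 4 * h ^ 3 * (p * ‖w‖ ^ 2) + (h ^ 2 * ‖w‖ ^ 2) ^ 2 := by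
      rw [hs]; ring
    have h2 : -(m * m ^ 2) ≤ p * ‖w‖ ^ 2 := by
      have : |p * ‖w‖ ^ 2| ≤ m * m ^ 2 := by
        rw [abs_mul, abs_of_nonneg (by positivity : 0 ≤ ‖w‖ ^ 2)]
        gcongr
      exact (abs_le.1 this).1
    have h3 := mul_le_mul_of_nonneg_left h2 (by positivity : 0 ≤ 4 * h ^ 3)
    nlinarith [sq_nonneg (h ^ 2 * ‖w‖ ^ 2)]
  have hlhs : ‖v + ε • w‖ ^ α = d ^ α * (1 + s) ^ (α / 2) := by
    have h1s : 0 ≤ 1 + s := by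
      have := (abs_le.1 hsabs).1
      linarith
    have e1 : ∀ t : ℝ, 0 ≤ t → t ^ α = (t ^ 2) ^ (α / 2) := fun t ht => by
      rw [← Real.rpow_natCast, ← Real.rpow_mul ht]
      congr 1
      push_cast
      ring
    rw [e1 _ (norm_nonneg _), hsq, Real.mul_rpow (by positivity) h1s, ← e1 d hd0.le]
  rw [hlhs]
  refine mul_le_mul_of_nonneg_left (ht.trans ?_) (by positivity)
  have hc : 0 ≤ α / 2 * (1 - α / 2) / 2 := by nlinarith
  have hc1 : α / 2 * (1 - α / 2) / 2 ≤ 1 := by nlinarith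
  have h4 := mul_le_mul_of_nonneg_left hs2 hc
  have h5 : α / 2 * (1 - α / 2) / 2 * (4 * (h * m) ^ 3) ≤ 1 * (4 * (h * m) ^ 3) := by gcongr
  have h6 : 0 ≤ (h * m) ^ 3 := by positivity
  have h7 : α / 2 * s = α * h * p + α / 2 * h ^ 2 * ‖w‖ ^ 2 := by rw [hs]; ring
  rw [h7]
  nlinarith

theorem measureReal_unitBall_pos : 0 < volume.real (ball (0 : E n) 1) :=
  ENNReal.toReal_pos (measure_ball_pos _ _ one_pos).ne' measure_ball_lt_top.ne

/-- Both regimes end here: the odd part of a pointwise bound disappears from the average. -/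
theorem setAverage_le_of_le {a : ℝ} {F l q : E n → ℝ} (hF : IntegrableOn F (ball 0 1))
    (hl : Continuous l) (hodd : ∀ y, l (-y) = -l y) (hq : IntegrableOn q (ball 0 1))
    (h : ∀ y ∈ ball (0 : E n) 1, F y ≤ a + l y + q y) :
    ⨍ y in ball (0 : E n) 1, F y ≤
      a + (volume.real (ball (0 : E n) 1))⁻¹ * ∫ y in ball (0 : E n) 1, q y := by
  have hV := measureReal_unitBall_pos (n := n)
  have hli := integrableOn_ball_of_continuous hl
  have hai : IntegrableOn (fun _ : E n => a) (ball 0 1) :=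
    integrableOn_ball_of_continuous continuous_const
  have h1 := setIntegral_mono_on hF ((hai.add hli).add hq) measurableSet_ball h
  have h2 : ∫ y in ball (0 : E n) 1, (((fun _ : E n => a) + l) + q) y =
      volume.real (ball (0 : E n) 1) * a + ∫ y in ball (0 : E n) 1, q y := by
    rw [integral_add' (hai.add hli) hq, integral_add' hai hli, setIntegral_ball_odd hodd]
    simp
  rw [setAverage_eq, smul_eq_mul]
  calc _ ≤ (volume.real (ball (0 : E n) 1))⁻¹ *
        (volume.real (ball (0 : E n) 1) * a + ∫ y in ball (0 : E n) 1, q y) := by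
        gcongr
        exact h1.trans h2.le
    _ = _ := by field_simp

theorem norm_toEuclideanLin_of_mem_orthogonalGroup {Q : Matrix (Fin n) (Fin n) ℝ}
    (hQ : Q ∈ orthogonalGroup (Fin n) ℝ) (y : E n) : ‖toEuclideanLin Q y‖ = ‖y‖ := by
  have h : ‖toEuclideanLin Q y‖ ^ 2 = ‖y‖ ^ 2 := by
    rw [← real_inner_self_eq_norm_sq, ← real_inner_self_eq_norm_sq,
      inner_toEuclideanLin]
    have : (toEuclideanLin Q y).ofLp = Q *ᵥ y.ofLp := rfl
    rw [this, dotProduct_mulVec, ← mulVec_transpose, mulVec_mulVec,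
      (mem_orthogonalGroup_iff' _ _).1 hQ, one_mulVec, EuclideanSpace.inner_eq_star_dotProduct]
    simp
  exact (sq_eq_sq₀ (norm_nonneg _) (norm_nonneg _)).1 h

theorem norm_toEuclideanLin_sqrt_mul_le (hl : 0 ≤ lam) (hB : B ∈ ellipticMatrices n lam Lam)
    {Q : Matrix (Fin n) (Fin n) ℝ} (hQ : Q ∈ orthogonalGroup (Fin n) ℝ) (y : E n) :
    ‖toEuclideanLin (CFC.sqrt B * Q) y‖ ≤ √Lam * ‖y‖ := by
  have h : toEuclideanLin (CFC.sqrt B * Q) y =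
      toEuclideanLin (CFC.sqrt B) (toEuclideanLin Q y) := by
    simp [toEuclideanLin]
  rw [h, ← norm_toEuclideanLin_of_mem_orthogonalGroup hQ y]
  exact norm_toEuclideanLin_sqrt_le hl hB _

/-- The combined displacements `A^{1/2} y ∓ B^{1/2} Q y`. -/
theorem norm_displacement_sub_le (hl : 0 ≤ lam) (hA : A ∈ ellipticMatrices n lam Lam)
    (hB : B ∈ ellipticMatrices n lam Lam) {Q : Matrix (Fin n) (Fin n) ℝ}
    (hQ : Q ∈ orthogonalGroup (Fin n) ℝ) (y : E n) :
    ‖toEuclideanLin (CFC.sqrt A - CFC.sqrt B * Q) y‖ ≤ 2 * √Lam * ‖y‖ := by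
  rw [map_sub, LinearMap.sub_apply]
  have := norm_toEuclideanLin_sqrt_le hl hA y
  have := norm_toEuclideanLin_sqrt_mul_le hl hB hQ y
  exact (norm_sub_le _ _).trans (by linarith)

theorem norm_displacement_add_le (hl : 0 ≤ lam) (hA : A ∈ ellipticMatrices n lam Lam)
    (hB : B ∈ ellipticMatrices n lam Lam) {Q : Matrix (Fin n) (Fin n) ℝ}
    (hQ : Q ∈ orthogonalGroup (Fin n) ℝ) (y : E n) :
    ‖toEuclideanLin (CFC.sqrt A + CFC.sqrt B * Q) y‖ ≤ 2 * √Lam * ‖y‖ := by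
  rw [map_add, LinearMap.add_apply]
  have := norm_toEuclideanLin_sqrt_le hl hA y
  have := norm_toEuclideanLin_sqrt_mul_le hl hB hQ y
  exact (norm_add_le _ _).trans (by linarith)

/-- The reflection in the hyperplane orthogonal to y₀ - y₁ exchanges the two vectors. -/
theorem exists_orthogonal_map_eq {y₀ y₁ : E n} (h : ‖y₀‖ = ‖y₁‖) :
    ∃ Q ∈ orthogonalGroup (Fin n) ℝ, toEuclideanLin Q y₀ = y₁ := by
  set g := (ℝ ∙ (y₀ - y₁))ᗮ.reflection
  set b := EuclideanSpace.basisFun (Fin n) ℝ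
  refine ⟨_, g.toMatrix_mem_unitaryGroup b b, ?_⟩
  rw [toEuclideanLin_eq_toLin_orthonormal, toLin_toMatrix]
  exact Submodule.reflection_sub h

theorem exists_toEuclideanLin_sqrt_eq_smul (hl : 0 < lam) (hA : A ∈ ellipticMatrices n lam Lam)
    {e : E n} (he : ‖e‖ = 1) :
    ∃ y : E n, ∃ a : ℝ, ‖y‖ = 1 ∧ √lam ≤ a ∧ toEuclideanLin (CFC.sqrt A) y = a • e := by
  have hs : 0 < √lam := Real.sqrt_pos.2 hl
  have hinj : Function.Injective (toEuclideanLin (CFC.sqrt A)) := by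
    rw [injective_iff_map_eq_zero]
    intro y hy
    have := le_norm_toEuclideanLin_sqrt hl.le hA y
    rw [hy, norm_zero] at this
    exact norm_eq_zero.1 (le_antisymm (nonpos_of_mul_nonpos_right this hs) (norm_nonneg _))
  obtain ⟨p, hp⟩ := LinearMap.injective_iff_surjective.1 hinj e
  have hp0 : p ≠ 0 := by
    rintro rfl
    rw [map_zero] at hp
    simp [← hp] at he
  have hpn : 0 < ‖p‖ := norm_pos_iff.2 hp0
  have hle := le_norm_toEuclideanLin_sqrt hl.le hA p
  rw [hp, he] at hle
  refine ⟨‖p‖⁻¹ • p, ‖p‖⁻¹, norm_smul_inv_norm hp0, ?_, by rw [map_smul, hp]⟩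
  rw [← one_div, le_div_iff₀ hpn]
  exact hle

/-- Some coupling moves a boundary point of the ball in the direction `-e`. -/
theorem exists_orthogonal_opposite (hl : 0 < lam) (hA : A ∈ ellipticMatrices n lam Lam)
    (hB : B ∈ ellipticMatrices n lam Lam) {e : E n} (he : ‖e‖ = 1) :
    ∃ Q ∈ orthogonalGroup (Fin n) ℝ, ∃ y : E n, ∃ κ : ℝ, ‖y‖ = 1 ∧ 2 * √lam ≤ κ ∧
      toEuclideanLin (CFC.sqrt A - CFC.sqrt B * Q) y = -(κ • e) := by
  obtain ⟨y₀, a, hy₀, ha, hAy⟩ := exists_toEuclideanLin_sqrt_eq_smul hl hA he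
  obtain ⟨y₁, b, hy₁, hb, hBy⟩ := exists_toEuclideanLin_sqrt_eq_smul hl hB he
  -- Q sends -y₀ to y₁, so the displacements -a e and b e are opposite and their difference is -(a +
  -- b) e.
  obtain ⟨Q, hQ, hQy⟩ := exists_orthogonal_map_eq (y₀ := -y₀) (y₁ := y₁) (by simp [hy₀, hy₁])
  refine ⟨Q, hQ, -y₀, a + b, by simpa using hy₀, by linarith, ?_⟩
  have h : toEuclideanLin (CFC.sqrt B * Q) (-y₀) =
      toEuclideanLin (CFC.sqrt B) (toEuclideanLin Q (-y₀)) := by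
    simp [toEuclideanLin]
  rw [map_sub, LinearMap.sub_apply, h, hQy, hBy, map_neg, hAy]
  module

end EllipsoidProcess

/-! ### The far regime, and growth of the step function -/

namespace EllipsoidProcess

open MeasureTheory Metric Matrix

variable {n : ℕ} {lam Lam : ℝ}

/-- The normalised second moment of a coordinate on the unit ball. -/
noncomputable def ballVariance (n : ℕ) : ℝ :=
  (volume.real (ball (0 : E n) 1))⁻¹ * secondMoment n

theorem ballVariance_pos (hn : 0 < n) : 0 < ballVariance n :=
  mul_pos (inv_pos.2 measureReal_unitBall_pos) (secondMoment_pos hn)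

theorem f₁_coupled_eq (C C' α ε : ℝ) (A : E n → Matrix (Fin n) (Fin n) ℝ) (x z : E n)
    (Q : Matrix (Fin n) (Fin n) ℝ) (y : E n) :
    coupled (f₁ C C' α) A ε x z Q y =
      C * ‖(x - z) + ε • toEuclideanLin (CFC.sqrt (A x) - CFC.sqrt (A z) * Q) y‖ ^ α +
      C' * (‖x + z‖ ^ 2 +
        2 * ε * inner ℝ (x + z) (toEuclideanLin (CFC.sqrt (A x) + CFC.sqrt (A z) * Q) y) +
        ε ^ 2 * ‖toEuclideanLin (CFC.sqrt (A x) + CFC.sqrt (A z) * Q) y‖ ^ 2) := by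
  have h1 : ∀ v w : E n, ‖v + ε • w‖ ^ 2 = ‖v‖ ^ 2 + 2 * ε * inner ℝ v w + ε ^ 2 * ‖w‖ ^ 2 :=
    fun v w => by
      rw [norm_add_sq_real, inner_smul_right, norm_smul, mul_pow, Real.norm_eq_abs, sq_abs]
      ring
  rw [← h1, coupled, f₁]
  congr 4
  · rw [map_sub, LinearMap.sub_apply, smul_sub]
    abel
  · rw [map_add, LinearMap.add_apply, smul_add]
    abel

theorem coupled_comparison_eq (C : ℝ) (N : ℕ) (α ε r : ℝ) (u : E n → ℝ)
    (A : E n → Matrix (Fin n) (Fin n) ℝ) (x z : E n) (Q : Matrix (Fin n) (Fin n) ℝ) (y : E n) :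
    coupled (comparison C N α lam ε r u) A ε x z Q y =
      coupled (f₁ C (2 / (3 * r ^ 2) * supBall u (2 * r)) α) A ε x z Q y -
        coupled (f₂ C N α lam ε) A ε x z Q y := rfl

theorem sq_norm_displacement_add_le (hl : 0 ≤ lam) (hL : 0 ≤ Lam)
    {A B : Matrix (Fin n) (Fin n) ℝ} (hA : A ∈ ellipticMatrices n lam Lam)
    (hB : B ∈ ellipticMatrices n lam Lam) {Q : Matrix (Fin n) (Fin n) ℝ}
    (hQ : Q ∈ orthogonalGroup (Fin n) ℝ) {y : E n} (hy : ‖y‖ ≤ 1) :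
    ‖toEuclideanLin (CFC.sqrt A + CFC.sqrt B * Q) y‖ ^ 2 ≤ 4 * Lam := by
  have h := norm_displacement_add_le hl hA hB hQ y
  have h2 : ‖toEuclideanLin (CFC.sqrt A + CFC.sqrt B * Q) y‖ ≤ 2 * √Lam :=
    h.trans (mul_le_of_le_one_right (by positivity) hy)
  calc _ ≤ (2 * √Lam) ^ 2 := pow_le_pow_left₀ (norm_nonneg _) h2 2
    _ = 4 * Lam := by rw [mul_pow, Real.sq_sqrt hL]; norm_num

set_option maxHeartbeats 1000000 in
/-- The second-order term dominates when `|x - z|` is large compared with `ε`. -/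
theorem exists_average_lt_of_far (hn : 0 < n) (hl : 0 < lam) (hL : 0 < Lam) {α : ℝ} (hα0 : 0 < α)
    (hα1 : α < 1) {c : ℝ} (hc0 : 0 < c)
    (hc : 2 * ((n - 1) * Lam - (1 - α) * lam) - 2 * (n * (1 - α) ^ (1 / (n : ℝ)) * lam) ≤ -c)
    {r ε : ℝ} (hε : 0 < ε) {A : E n → Matrix (Fin n) (Fin n) ℝ} {u : E n → ℝ}
    {x z : E n} (hA : A x ∈ ellipticMatrices n lam Lam) (hB : A z ∈ ellipticMatrices n lam Lam)
    {C : ℝ} {N : ℕ} (hC : 1 ≤ C) (hS : 0 ≤ supBall u (2 * r))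
    (h6 : 6 * (2 * √Lam) ≤ C * √lam)
    (h110 : 110 * (2 * √Lam) ^ 3 ≤ α / 4 * (ballVariance n * c) * (C * √lam))
    (hbig : 4 * Lam * (2 / (3 * r ^ 2) * supBall u (2 * r)) + 1 <
      C * ((2 * r) ^ (α - 2) * (α / 4 * (ballVariance n * c))))
    (hd : ‖x - z‖ < 2 * r) (hfar : C * √lam * ε < ‖x - z‖)
    (hf₂ : f₂ C N α lam ε x z = 0) :
    ∃ Q ∈ orthogonalGroup (Fin n) ℝ,
      (⨍ y in ball (0 : E n) 1, coupled (comparison C N α lam ε r u) A ε x z Q y) + ε ^ 2 <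
        comparison C N α lam ε r u x z := by
  set C' := 2 / (3 * r ^ 2) * supBall u (2 * r)
  have hC'0 : 0 ≤ C' := by positivity
  have hsl : 0 < √lam := Real.sqrt_pos.2 hl
  have hsL : 0 < √Lam := Real.sqrt_pos.2 hL
  set v := x - z with hv
  set d := ‖v‖ with hdv
  have hd0 : 0 < d := lt_trans (by positivity) hfar
  have hv0 : v ≠ 0 := norm_pos_iff.1 hd0
  set e : Fin n → ℝ := (d⁻¹ • v).ofLp with he_def
  have he : e ⬝ᵥ e = 1 := by
    have h1 := real_inner_self_eq_norm_sq (d⁻¹ • v)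
    rw [show ‖d⁻¹ • v‖ = 1 from norm_smul_inv_norm hv0, EuclideanSpace.inner_eq_star_dotProduct] at h1
    simpa [he_def] using h1
  obtain ⟨Q, hQ, htr⟩ := exists_orthogonal_trace_hessian_le hn hl hA hB hα1 he
  refine ⟨Q, hQ, ?_⟩
  set M := CFC.sqrt (A x) - CFC.sqrt (A z) * Q
  set P := CFC.sqrt (A x) + CFC.sqrt (A z) * Q
  set T := Mᵀ * hessian α e * M
  set h := ε / d with hh
  set m := 2 * √Lam
  have hh0 : 0 < h := div_pos hε hd0
  have hhC : h * (C * √lam) ≤ 1 := by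
    rw [hh, div_mul_eq_mul_div, div_le_one hd0]
    linarith
  have hquad : ∀ y : E n, ‖toEuclideanLin M y‖ ^ 2 -
      (2 - α) * (inner ℝ v (toEuclideanLin M y) / d) ^ 2 = y.ofLp ⬝ᵥ T *ᵥ y.ofLp := by
    intro y
    have h1 : y.ofLp ⬝ᵥ T *ᵥ y.ofLp = (M *ᵥ y.ofLp) ⬝ᵥ hessian α e *ᵥ (M *ᵥ y.ofLp) := by
      simp only [T, ← mulVec_mulVec]
      rw [dotProduct_mulVec y.ofLp, vecMul_transpose]
    have h2 : inner ℝ v (toEuclideanLin M y) / d = e ⬝ᵥ M *ᵥ y.ofLp := by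
      rw [inner_toEuclideanLin, he_def]
      simp [smul_dotProduct, div_eq_inv_mul]
    have h3 : ‖toEuclideanLin M y‖ ^ 2 = (M *ᵥ y.ofLp) ⬝ᵥ (M *ᵥ y.ofLp) := by
      rw [← real_inner_self_eq_norm_sq, inner_toEuclideanLin]
      rfl
    rw [h1, dotProduct_hessian_mulVec, h2, h3]
  have hMc : Continuous (toEuclideanLin M) := LinearMap.continuous_of_finiteDimensional _
  have hPc : Continuous (toEuclideanLin P) := LinearMap.continuous_of_finiteDimensional _
  have hqi : IntegrableOn (fun y : E n => C * d ^ α * (α / 2 * h ^ 2) *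
      (y.ofLp ⬝ᵥ T *ᵥ y.ofLp)) (ball 0 1) := by
    refine integrableOn_ball_of_continuous ?_
    simp only [← hquad]
    fun_prop
  have hpt : ∀ y ∈ ball (0 : E n) 1, coupled (comparison C N α lam ε r u) A ε x z Q y ≤
      (C * d ^ α * (1 + 110 * h ^ 3 * m ^ 3) + C' * (‖x + z‖ ^ 2 + ε ^ 2 * (4 * Lam))) +
      (C * d ^ α * (α * h * (inner ℝ v (toEuclideanLin M y) / d)) +
        C' * (2 * ε * inner ℝ (x + z) (toEuclideanLin P y))) +
      C * d ^ α * (α / 2 * h ^ 2) * (y.ofLp ⬝ᵥ T *ᵥ y.ofLp) := by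
    intro y hy
    have hy1 : ‖y‖ ≤ 1 := by simpa using (mem_ball_zero_iff.1 hy).le
    rw [coupled_comparison_eq, f₁_coupled_eq]
    have hw : ‖toEuclideanLin M y‖ ≤ m :=
      (norm_displacement_sub_le hl.le hA hB hQ y).trans
        (mul_le_of_le_one_right (by positivity) hy1)
    have h1 := norm_add_smul_rpow_le hα0 hα1 hv0 hε hw (by nlinarith)
    rw [hquad] at h1
    have h2 := sq_norm_displacement_add_le hl.le hL.le hA hB hQ hy1
    have h3 : 0 ≤ coupled (f₂ C N α lam ε) A ε x z Q y := f₂_nonneg hε.le _ _ _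
    have h4 := mul_le_mul_of_nonneg_left h1 (by linarith : 0 ≤ C)
    have h5 : C' * (ε ^ 2 * ‖toEuclideanLin P y‖ ^ 2) ≤ C' * (ε ^ 2 * (4 * Lam)) := by gcongr
    linarith
  have havg := setAverage_le_of_le (integrableOn_coupled hC hα0.le hε.le N u A x z Q)
    (l := fun y => C * d ^ α * (α * h * (inner ℝ v (toEuclideanLin M y) / d)) +
      C' * (2 * ε * inner ℝ (x + z) (toEuclideanLin P y))) (by fun_prop)
    (fun y => by simp only [map_neg, inner_neg_right]; ring) hqi hpt
  rw [integral_const_mul, setIntegral_ball_quadratic] at havg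
  have hκ := ballVariance_pos hn
  have hX : 0 < C * d ^ α * h ^ 2 := by positivity
  have h1 : (volume.real (ball (0 : E n) 1))⁻¹ * (C * d ^ α * (α / 2 * h ^ 2) *
      (secondMoment n * T.trace)) = C * d ^ α * h ^ 2 * (α / 2 * (ballVariance n * T.trace)) := by
    rw [ballVariance]; ring
  rw [h1] at havg
  have h2 : ballVariance n * T.trace ≤ ballVariance n * -c := by
    gcongr
    exact htr.trans hc
  -- As h ≤ 1/(C √λ), the cubic remainder uses at most half of the second-order gain, leaving the
  -- coefficient α/4.
  have h3 : 110 * h * m ^ 3 ≤ α / 4 * (ballVariance n * c) := by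
    calc 110 * h * m ^ 3 = h * (110 * m ^ 3) := by ring
      _ ≤ h * (α / 4 * (ballVariance n * c) * (C * √lam)) := by gcongr
      _ = α / 4 * (ballVariance n * c) * (h * (C * √lam)) := by ring
      _ ≤ α / 4 * (ballVariance n * c) := mul_le_of_le_one_right (by positivity) hhC
  have h4 : d ^ α * h ^ 2 = d ^ (α - 2) * ε ^ 2 := by
    rw [hh, Real.rpow_sub hd0, Real.rpow_two]
    field_simp
  -- The exponent is negative, so d < 2r bounds the gain below by a multiple of C ε², uniformly in
  -- d.
  have h5 : (2 * r) ^ (α - 2) ≤ d ^ (α - 2) :=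
    Real.rpow_le_rpow_of_nonpos hd0 hd.le (by linarith)
  have h7 : (4 * Lam * C' + 1) * ε ^ 2 <
      C * d ^ α * h ^ 2 * (α / 4 * (ballVariance n * c)) := by
    calc (4 * Lam * C' + 1) * ε ^ 2 <
        C * ((2 * r) ^ (α - 2) * (α / 4 * (ballVariance n * c))) * ε ^ 2 := by gcongr
      _ ≤ C * (d ^ (α - 2) * (α / 4 * (ballVariance n * c))) * ε ^ 2 := by gcongr
      _ = C * (d ^ (α - 2) * ε ^ 2) * (α / 4 * (ballVariance n * c)) := by ring
      _ = _ := by rw [← h4]; ring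
  have h8 := mul_le_mul_of_nonneg_left h3 hX.le
  have h9 : C * d ^ α * h ^ 2 * (α / 2 * (ballVariance n * T.trace)) ≤
      C * d ^ α * h ^ 2 * (α / 2 * (ballVariance n * -c)) := by gcongr
  have h10 : comparison C N α lam ε r u x z = C * d ^ α + C' * ‖x + z‖ ^ 2 := by
    rw [comparison, hf₂, f₁, sub_zero]
  rw [h10]
  nlinarith

/-- A drop by √λ ε/2 lowers the index by at least one, and each index is worth a factor C². The
first entry of the maximum covers a new index of at most 1, since the old one is at least 2. -/
theorem f₂_annulus_below {C α ε : ℝ} {N : ℕ} (hC : 1 ≤ C) (hε : 0 < ε) (hl : 0 < lam)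
    {x z x' z' : E n} (hlo : 1 / 2 * √lam * ε < ‖x - z‖) (hhi : ‖x - z‖ ≤ N * √lam * ε)
    (hdrop : ‖x' - z'‖ ≤ max (1 / 2 * √lam * ε) (‖x - z‖ - 1 / 2 * √lam * ε)) :
    ε ^ α ≤ f₂ C N α lam ε x z ∧ C ^ 2 * f₂ C N α lam ε x z ≤ f₂ C N α lam ε x' z' := by
  have hs : 0 < √lam * ε := mul_pos (Real.sqrt_pos.2 hl) hε
  rw [f₂_eq hε.le, f₂_eq hε.le]
  set t := 2 * (‖x - z‖ / (√lam * ε)) with ht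
  set t' := 2 * (‖x' - z'‖ / (√lam * ε)) with ht'
  have h1 : ⌈t⌉₊ ≤ 2 * N := by
    rw [Nat.ceil_le, ht]
    push_cast
    gcongr
    rw [div_le_iff₀ hs]
    linarith
  have h1t : 1 < t := by
    have : 1 / 2 < ‖x - z‖ / (√lam * ε) := by
      rw [lt_div_iff₀ hs]
      linarith
    linarith
  have h2 : ⌈t'⌉₊ + 1 ≤ ⌈t⌉₊ := by
    rcases le_max_iff.1 hdrop with h | h
    · have h3 : t' ≤ (1 : ℕ) := by
        have : ‖x' - z'‖ / (√lam * ε) ≤ 1 / 2 := by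
          rw [div_le_iff₀ hs]
          linarith
        push_cast
        linarith
      have h4 : 1 < ⌈t⌉₊ := Nat.lt_ceil.2 (by exact_mod_cast h1t)
      have := Nat.ceil_le.2 h3
      omega
    · have h3 : t' ≤ t - 1 := by
        have h4 : ‖x' - z'‖ / (√lam * ε) ≤ ‖x - z‖ / (√lam * ε) - 1 / 2 := by
          rw [div_le_iff₀ hs, sub_mul, div_mul_cancel₀ _ hs.ne']
          linarith
        linarith
      have h5 : ⌈t - 1⌉₊ + 1 = ⌈t⌉₊ := by
        rw [← Nat.ceil_add_one (by linarith)]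
        congr 1
        ring
      have := Nat.ceil_mono h3
      omega
  rw [if_pos h1, if_pos (by omega)]
  constructor
  · exact le_mul_of_one_le_left (by positivity) (one_le_pow₀ hC)
  · rw [← mul_assoc, ← pow_add]
    exact mul_le_mul_of_nonneg_right (pow_le_pow_right₀ hC (by omega)) (by positivity)

end EllipsoidProcess

/-! ### The near regime -/

namespace EllipsoidProcess

open MeasureTheory Metric Matrix

variable {n : ℕ} {lam Lam : ℝ}

theorem setIntegral_indicator_ball_const (hn : 0 < n) {δ : ℝ} (hδ : 0 ≤ δ) {y₀ : E n} (b : ℝ)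
    (hsub : ball y₀ δ ⊆ ball 0 1) :
    (volume.real (ball (0 : E n) 1))⁻¹ *
      ∫ y in ball (0 : E n) 1, (ball y₀ δ).indicator (fun _ => b) y = δ ^ n * b := by
  have : Nonempty (Fin n) := ⟨⟨0, hn⟩⟩
  have hV := measureReal_unitBall_pos (n := n)
  rw [setIntegral_indicator measurableSet_ball, Set.inter_eq_self_of_subset_right hsub,
    setIntegral_const, smul_eq_mul, measureReal_def (s := ball y₀ δ),
    Measure.addHaar_ball _ _ hδ, ENNReal.toReal_mul, ENNReal.toReal_ofReal (by positivity),
    ← measureReal_def]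
  simp only [finrank_euclideanSpace, Fintype.card_fin]
  field_simp

/-- The annular step function dominates when `|x - z|` is comparable with `ε`. -/
theorem exists_average_lt_of_near (hn : 0 < n) (hl : 0 < lam) (hL : lam ≤ Lam) {α : ℝ}
    (hα0 : 0 < α) (hα1 : α < 1)
    {r ε : ℝ} (hr : 0 < r) (hε : 0 < ε) {A : E n → Matrix (Fin n) (Fin n) ℝ} {u : E n → ℝ}
    {x z : E n} (hA : A x ∈ ellipticMatrices n lam Lam) (hB : A z ∈ ellipticMatrices n lam Lam)
    {C : ℝ} {N : ℕ} (hC : 1 ≤ C) (hS : 0 ≤ supBall u (2 * r))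
    (hbig : (4 * Lam * (2 / (3 * r ^ 2) * supBall u (2 * r)) + 1) * (4 * r / √lam) ^ (2 - α) +
      C * (2 * √Lam) ^ α + 1 < C ^ 2 * (√lam / (8 * √Lam)) ^ n)
    (hd : ‖x - z‖ < 2 * r) (hlo : 1 / 2 * √lam * ε < ‖x - z‖) (hhi : ‖x - z‖ ≤ N * √lam * ε) :
    ∃ Q ∈ orthogonalGroup (Fin n) ℝ,
      (⨍ y in ball (0 : E n) 1, coupled (comparison C N α lam ε r u) A ε x z Q y) + ε ^ 2 <
        comparison C N α lam ε r u x z := by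
  have hL0 : 0 < Lam := hl.trans_le hL
  set C' := 2 / (3 * r ^ 2) * supBall u (2 * r)
  have hC'0 : 0 ≤ C' := by positivity
  have hsl : 0 < √lam := Real.sqrt_pos.2 hl
  have hsL : 0 < √Lam := Real.sqrt_pos.2 hL0
  have hsle : √lam ≤ √Lam := Real.sqrt_le_sqrt hL
  set v := x - z with hv
  set d := ‖v‖ with hdv
  have hd0 : 0 < d := lt_trans (by positivity) hlo
  have hv0 : v ≠ 0 := norm_pos_iff.1 hd0
  obtain ⟨Q, hQ, y₁, κ, hy₁, hκ, hMy⟩ :=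
    exists_orthogonal_opposite hl hA hB (e := d⁻¹ • v) (norm_smul_inv_norm hv0)
  refine ⟨Q, hQ, ?_⟩
  set M := CFC.sqrt (A x) - CFC.sqrt (A z) * Q
  set P := CFC.sqrt (A x) + CFC.sqrt (A z) * Q
  -- The centre t y₁ chosen below shortens x - z by (3/4) √λ ε; moving y by less than δ changes this
  -- by at most 2 √Λ δ ε = √λ ε/4, leaving √λ ε/2.
  set δ := √lam / (8 * √Lam) with hδ
  have hδ0 : 0 < δ := by positivity
  have hδ1 : δ ≤ 1 / 8 := by
    rw [hδ, div_le_iff₀ (by positivity)]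
    linarith
  have hκ0 : 0 < κ := by linarith
  set t := 3 / 4 * √lam / κ with ht
  have ht0 : 0 < t := by positivity
  have ht1 : t ≤ 3 / 8 := by
    rw [ht, div_le_iff₀ hκ0]
    linarith
  have htκ : t * κ = 3 / 4 * √lam := div_mul_cancel₀ _ hκ0.ne'
  have hball : ball (t • y₁) δ ⊆ ball (0 : E n) 1 := by
    refine ball_subset_ball' ?_
    rw [dist_zero_right, norm_smul, hy₁, Real.norm_of_nonneg ht0.le]
    linarith
  have hdrop : ∀ y ∈ ball (t • y₁) δ, ‖v + ε • toEuclideanLin M y‖ ≤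
      max (1 / 2 * √lam * ε) (d - 1 / 2 * √lam * ε) := by
    intro y hy
    have hy' : ‖y - t • y₁‖ < δ := mem_ball_iff_norm.1 hy
    have h1 : v + ε • toEuclideanLin M y = (1 - ε * (t * κ) / d) • v +
        ε • toEuclideanLin M (y - t • y₁) := by
      rw [map_sub (toEuclideanLin M), map_smul (toEuclideanLin M), hMy]
      module
    have h2 : ‖toEuclideanLin M (y - t • y₁)‖ ≤ √lam / 4 :=
      calc _ ≤ 2 * √Lam * ‖y - t • y₁‖ := norm_displacement_sub_le hl.le hA hB hQ _
        _ ≤ 2 * √Lam * δ := by gcongr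
        _ = √lam / 4 := by rw [hδ]; field_simp; norm_num
    have h3 : ‖(1 - ε * (t * κ) / d) • v‖ = |d - ε * (3 / 4 * √lam)| := by
      rw [norm_smul, ← hdv, htκ, Real.norm_eq_abs]
      nth_rewrite 2 [← abs_of_pos hd0]
      rw [← abs_mul]
      congr 1
      field_simp
    have h4 : ‖ε • toEuclideanLin M (y - t • y₁)‖ ≤ ε * (√lam / 4) := by
      rw [norm_smul, Real.norm_of_nonneg hε.le]
      gcongr
    have h5 : |d - ε * (3 / 4 * √lam)| + ε * (√lam / 4) ≤
        max (1 / 2 * √lam * ε) (d - 1 / 2 * √lam * ε) := by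
      rcases le_total 0 (d - ε * (3 / 4 * √lam)) with h | h
      · rw [abs_of_nonneg h]
        exact le_max_of_le_right (by linarith)
      -- Overshoot: the vector reverses, and its length is at most √λ ε - d, which is below √λ ε/2
      -- because d > √λ ε/2.
      · rw [abs_of_nonpos h]
        exact le_max_of_le_left (by linarith)
    rw [h1]
    exact (norm_add_le _ _).trans (by rw [h3]; linarith)
  set F := f₂ C N α lam ε x z with hF
  have hF0 : ε ^ α ≤ F :=
    -- Only the bound on f₂(x, z) is wanted, so the second pair is a dummy at distance zero.
    (f₂_annulus_below (x' := x) (z' := x) hC hε hl hlo hhi (by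
      rw [sub_self, norm_zero]
      exact le_max_of_le_left (by positivity))).1
  have hpt : ∀ y ∈ ball (0 : E n) 1, coupled (comparison C N α lam ε r u) A ε x z Q y ≤
      (C * (d ^ α + (2 * √Lam * ε) ^ α) + C' * (‖x + z‖ ^ 2 + ε ^ 2 * (4 * Lam))) +
      C' * (2 * ε * inner ℝ (x + z) (toEuclideanLin P y)) +
      (ball (t • y₁) δ).indicator (fun _ => -(C ^ 2 * F)) y := by
    intro y hy
    have hy1 : ‖y‖ ≤ 1 := by simpa using (mem_ball_zero_iff.1 hy).le
    have hw : ‖ε • toEuclideanLin M y‖ ≤ 2 * √Lam * ε := by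
      rw [norm_smul, Real.norm_of_nonneg hε.le, mul_comm]
      gcongr
      exact (norm_displacement_sub_le hl.le hA hB hQ y).trans
        (mul_le_of_le_one_right (by positivity) hy1)
    -- No expansion is needed: subadditivity of t ↦ t^α costs only a multiple of ε^α.
    have h1 : ‖v + ε • toEuclideanLin M y‖ ^ α ≤ d ^ α + (2 * √Lam * ε) ^ α :=
      calc _ ≤ (d + 2 * √Lam * ε) ^ α := by
            gcongr
            exact (norm_add_le _ _).trans (by linarith)
        _ ≤ _ := Real.rpow_add_le_add_rpow hd0.le (by positivity) hα0.le hα1.le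
    have h2 := sq_norm_displacement_add_le hl.le hL0.le hA hB hQ hy1
    have h4 := mul_le_mul_of_nonneg_left h1 (by linarith : 0 ≤ C)
    have h5 : C' * (ε ^ 2 * ‖toEuclideanLin P y‖ ^ 2) ≤ C' * (ε ^ 2 * (4 * Lam)) := by gcongr
    have h6 : -coupled (f₂ C N α lam ε) A ε x z Q y ≤
        (ball (t • y₁) δ).indicator (fun _ => -(C ^ 2 * F)) y := by
      by_cases hyt : y ∈ ball (t • y₁) δ
      · rw [Set.indicator_of_mem hyt, neg_le_neg_iff]
        refine (f₂_annulus_below hC hε hl hlo hhi ?_).2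
        convert hdrop y hyt using 2
        rw [hv, map_sub, LinearMap.sub_apply, smul_sub]
        abel
      · rw [Set.indicator_of_notMem hyt, neg_nonpos]
        exact f₂_nonneg hε.le _ _ _
    rw [coupled_comparison_eq, f₁_coupled_eq]
    linarith
  have hPc : Continuous (toEuclideanLin P) := LinearMap.continuous_of_finiteDimensional _
  have hqi : IntegrableOn ((ball (t • y₁) δ).indicator (fun _ : E n => -(C ^ 2 * F)))
      (ball 0 1) := (integrableOn_ball_of_continuous continuous_const).indicator measurableSet_ball
  have havg := setAverage_le_of_le (integrableOn_coupled hC hα0.le hε.le N u A x z Q)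
    (l := fun y => C' * (2 * ε * inner ℝ (x + z) (toEuclideanLin P y))) (by fun_prop)
    (fun y => by simp only [map_neg, inner_neg_right]; ring) hqi hpt
  rw [setIntegral_indicator_ball_const hn hδ0.le _ hball] at havg
  -- The bounds √λ ε/2 < d < 2r force ε < 4r/√λ, so ε² errors reduce to ε^α with constants
  -- independent of ε.
  have hεα : ε ^ 2 ≤ ε ^ α * (4 * r / √lam) ^ (2 - α) := by
    have h1 : ε ≤ 4 * r / √lam := by
      rw [le_div_iff₀ hsl]
      linarith
    calc ε ^ 2 = ε ^ α * ε ^ (2 - α) := by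
          rw [← Real.rpow_add hε, add_sub_cancel, Real.rpow_two]
      _ ≤ _ := by
          gcongr
          linarith
  have h1 : (2 * √Lam * ε) ^ α = (2 * √Lam) ^ α * ε ^ α :=
    Real.mul_rpow (by positivity) hε.le
  have h2 : comparison C N α lam ε r u x z = C * d ^ α + C' * ‖x + z‖ ^ 2 - F := rfl
  rw [h1] at havg
  rw [h2]
  have hεα0 : 0 < ε ^ α := by positivity
  have h3 : (4 * Lam * C' + 1) * ε ^ 2 ≤
      (4 * Lam * C' + 1) * (ε ^ α * (4 * r / √lam) ^ (2 - α)) := by gcongr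
  have h4 : 0 ≤ C ^ 2 * δ ^ n - 1 := by
    have : 0 ≤ (4 * Lam * C' + 1) * (4 * r / √lam) ^ (2 - α) + C * (2 * √Lam) ^ α := by positivity
    linarith
  have h5 := mul_le_mul_of_nonneg_left hF0 h4
  have h6 := mul_lt_mul_of_pos_right hbig hεα0
  nlinarith

/-! ### Choice of the constants -/

/-- Every sufficiently small exponent is admissible. -/
theorem exists_forall_smallExponent
    (h : Lam / lam < ((n : ℝ) + 1) / ((n : ℝ) - 1)) :
    ∃ α₀ : ℝ, 0 < α₀ ∧ ∀ α : ℝ, 0 < α → α < α₀ → SmallExponent n lam Lam α := by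
  have hc : ContinuousAt (fun α : ℝ =>
      ((n : ℝ) * (1 - α) ^ (1 / (n : ℝ)) + (1 - α)) / ((n : ℝ) - 1)) 0 := by
    have : ContinuousAt (fun α : ℝ => (1 - α) ^ (1 / (n : ℝ))) 0 :=
      ContinuousAt.rpow_const (by fun_prop) (Or.inl (by norm_num))
    fun_prop
  -- At α = 0 the admissibility bound equals (n + 1)/(n - 1), so continuity suffices.
  have hev := hc.eventually (lt_mem_nhds (a := Lam / lam) (by simpa using h))
  obtain ⟨δ, hδ, hball⟩ := Metric.eventually_nhds_iff.1 hev
  refine ⟨min δ 1, lt_min hδ one_pos, fun α h0 h1 => ⟨h0, h1.trans_le (min_le_right _ _), ?_⟩⟩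
  refine hball ?_
  rw [Real.dist_eq, sub_zero, abs_of_pos h0]
  exact h1.trans_le (min_le_left _ _)

/-- The strict gap in the trace condition for an admissible exponent. -/
noncomputable def ellipticityGap (n : ℕ) (lam Lam α : ℝ) : ℝ :=
  2 * (n * (1 - α) ^ (1 / (n : ℝ)) * lam) - 2 * ((n - 1) * Lam - (1 - α) * lam)

theorem SmallExponent.ellipticityGap_pos {α : ℝ} (hn : 2 ≤ n) (hl : 0 < lam)
    (h : SmallExponent n lam Lam α) : 0 < ellipticityGap n lam Lam α := by
  have hn' : (0 : ℝ) < n - 1 := by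
    have : (2 : ℝ) ≤ n := by exact_mod_cast hn
    linarith
  have := h.2.2
  rw [div_lt_div_iff₀ hl hn'] at this
  rw [ellipticityGap]
  linarith

/-- A lower bound for the constant `C` that only depends on the data. -/
theorem exists_lower_bound (n : ℕ) (lam Lam r α S : ℝ) :
    ∃ C₀ : ℝ, 2 ≤ n → 0 < lam → 0 < Lam → 0 < r → SmallExponent n lam Lam α → ∀ C, C₀ ≤ C →
      1 ≤ C ∧ 6 * (2 * √Lam) ≤ C * √lam ∧
      110 * (2 * √Lam) ^ 3 ≤
        α / 4 * (ballVariance n * ellipticityGap n lam Lam α) * (C * √lam) ∧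
      4 * Lam * (2 / (3 * r ^ 2) * S) + 1 <
        C * ((2 * r) ^ (α - 2) * (α / 4 * (ballVariance n * ellipticityGap n lam Lam α))) ∧
      (4 * Lam * (2 / (3 * r ^ 2) * S) + 1) * (4 * r / √lam) ^ (2 - α) +
        C * (2 * √Lam) ^ α + 1 < C ^ 2 * (√lam / (8 * √Lam)) ^ n := by
  -- The hypotheses sit under the existential so that C₀ can be chosen as a function of the numbers
  -- alone; outside the admissible range 0 is a dummy value.
  by_cases h : 2 ≤ n ∧ 0 < lam ∧ 0 < Lam ∧ 0 < r ∧ SmallExponent n lam Lam α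
  swap
  · exact ⟨0, fun h1 h2 h3 h4 h5 => (h ⟨h1, h2, h3, h4, h5⟩).elim⟩
  obtain ⟨hn, hl, hL, hr, hα⟩ := h
  have hgap := hα.ellipticityGap_pos hn hl
  have hα0 := hα.1
  have hκ := ballVariance_pos (n := n) (by omega)
  have hsl : 0 < √lam := Real.sqrt_pos.2 hl
  have hsL : 0 < √Lam := Real.sqrt_pos.2 hL
  have key : ∀ a b : ℝ, 0 < b → ∀ᶠ C : ℝ in Filter.atTop, a < C * b := fun a b hb =>
    (Filter.tendsto_id.atTop_mul_const hb).eventually_gt_atTop a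
  have hev := (((key 1 1 one_pos).and (key (6 * (2 * √Lam)) (√lam) hsl)).and
    (key (110 * (2 * √Lam) ^ 3) (α / 4 * (ballVariance n * ellipticityGap n lam Lam α) * √lam)
      (by positivity))).and ((key (4 * Lam * (2 / (3 * r ^ 2) * S) + 1)
      ((2 * r) ^ (α - 2) * (α / 4 * (ballVariance n * ellipticityGap n lam Lam α)))
      (by positivity)).and
    (key (|(4 * Lam * (2 / (3 * r ^ 2) * S) + 1) * (4 * r / √lam) ^ (2 - α)| +
      (2 * √Lam) ^ α + 1) ((√lam / (8 * √Lam)) ^ n) (by positivity)))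
  obtain ⟨C₀, hC₀⟩ := Filter.eventually_atTop.1 hev
  refine ⟨C₀, fun _ _ _ _ _ C hC => ?_⟩
  obtain ⟨⟨⟨h1, h2⟩, h3⟩, h4, h5⟩ := hC₀ C hC
  rw [mul_one] at h1
  refine ⟨h1.le, h2.le, by linarith, h4, ?_⟩
  set Y := (4 * Lam * (2 / (3 * r ^ 2) * S) + 1) * (4 * r / √lam) ^ (2 - α)
  -- The condition quadratic in C follows from a linear one multiplied by C, since |Y| ≤ C |Y|.
  have h6 := mul_lt_mul_of_pos_left h5 (by linarith : 0 < C)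
  have h7 : |Y| ≤ C * |Y| := le_mul_of_one_le_left (abs_nonneg _) h1.le
  have h8 := le_abs_self Y
  linarith

end EllipsoidProcess

theorem mainTheorem3 :
    -- `C₀` depends on `n, lam, Lam, r, α, sup_{B_{2r}} |u|`, and `N₀` on `lam, Lam, C`
    ∃ (C₀ : ℕ → ℝ → ℝ → ℝ → ℝ → ℝ → ℝ) (N₀ : ℝ → ℝ → ℝ → ℕ),
      ∀ (n : ℕ) (lam Lam : ℝ), 2 ≤ n → 0 < lam → 1 ≤ Lam / lam →
        Lam / lam < ((n : ℝ) + 1) / ((n : ℝ) - 1) →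
        (∃ α₀ : ℝ, 0 < α₀ ∧ ∀ α : ℝ, 0 < α → α < α₀ →
          EllipsoidProcess.SmallExponent n lam Lam α) ∧
        ∀ α : ℝ, EllipsoidProcess.SmallExponent n lam Lam α →
        ∀ (r ε : ℝ), 0 < r → 0 < ε →
        ∀ (Ω : Set (EllipsoidProcess.E n))
          (A : EllipsoidProcess.E n → Matrix (Fin n) (Fin n) ℝ)
          (u : EllipsoidProcess.E n → ℝ),
          Metric.ball (0 : EllipsoidProcess.E n) (2 * r) ⊆ Ω →
          (∀ x ∈ Ω, A x ∈ EllipsoidProcess.ellipticMatrices n lam Lam) →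
          BddAbove ((fun x => |u x|) '' Metric.ball (0 : EllipsoidProcess.E n) (2 * r)) →
        ∀ (C : ℝ) (N : ℕ),
          C₀ n lam Lam r α (EllipsoidProcess.supBall u (2 * r)) ≤ C → N₀ lam Lam C ≤ N →
        ∀ x ∈ Metric.ball (0 : EllipsoidProcess.E n) r,
        ∀ z ∈ Metric.ball (0 : EllipsoidProcess.E n) r,
          1 / 2 * √lam * ε < ‖x - z‖ →
          ∃ Q ∈ Matrix.orthogonalGroup (Fin n) ℝ,
            MeasureTheory.IntegrableOn
              (EllipsoidProcess.coupled (EllipsoidProcess.comparison C N α lam ε r u) A ε x z Q)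
              (Metric.ball 0 1) ∧
            (⨍ y in Metric.ball (0 : EllipsoidProcess.E n) 1,
              EllipsoidProcess.coupled (EllipsoidProcess.comparison C N α lam ε r u) A ε x z Q y)
                + ε ^ 2
              < EllipsoidProcess.comparison C N α lam ε r u x z := by
  choose C₀ hC₀ using EllipsoidProcess.exists_lower_bound
  -- N ≥ C makes every pair beyond the last annulus satisfy d > C √λ ε, as the far regime requires.
  refine ⟨C₀, fun _ _ C => ⌈C⌉₊, ?_⟩
  intro n lam Lam hn hl hLl hdist
  refine ⟨EllipsoidProcess.exists_forall_smallExponent hdist, ?_⟩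
  intro α hα r ε hr hε Ω A u hΩ hA hu C N hC hN x hx z hz hxz
  have hL : lam ≤ Lam := (one_le_div hl).1 hLl
  have hL0 : 0 < Lam := hl.trans_le hL
  obtain ⟨h1, h2, h3, h4, h5⟩ := hC₀ n lam Lam r α _ hn hl hL0 hr hα C hC
  have hsub : Metric.ball (0 : EllipsoidProcess.E n) r ⊆ Ω :=
    (Metric.ball_subset_ball (by linarith)).trans hΩ
  have hS : 0 ≤ EllipsoidProcess.supBall u (2 * r) :=
    Real.sSup_nonneg (by rintro _ ⟨y, -, rfl⟩; exact abs_nonneg _)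
  have hd : ‖x - z‖ < 2 * r := by
    rw [mem_ball_zero_iff] at hx hz
    exact (norm_sub_le _ _).trans_lt (by linarith)
  have hAx := hA x (hsub hx)
  have hAz := hA z (hsub hz)
  obtain ⟨Q, hQ, hlt⟩ : ∃ Q ∈ Matrix.orthogonalGroup (Fin n) ℝ,
      (⨍ y in Metric.ball (0 : EllipsoidProcess.E n) 1,
        EllipsoidProcess.coupled (EllipsoidProcess.comparison C N α lam ε r u) A ε x z Q y)
          + ε ^ 2 < EllipsoidProcess.comparison C N α lam ε r u x z := by
    rcases le_or_gt ‖x - z‖ (N * √lam * ε) with hnear | hfar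
    · exact EllipsoidProcess.exists_average_lt_of_near (by omega) hl hL hα.1 hα.2.1 hr hε hAx hAz
        h1 hS h5 hd hxz hnear
    · refine EllipsoidProcess.exists_average_lt_of_far (by omega) hl hL0 hα.1 hα.2.1
        (hα.ellipticityGap_pos hn hl) (by rw [EllipsoidProcess.ellipticityGap]; linarith) hε
        hAx hAz h1 hS h2 h3 h4 hd ?_ ?_
      · refine lt_of_le_of_lt ?_ hfar
        gcongr
        exact Nat.ceil_le.1 hN
      · have hs : 0 < √lam * ε := mul_pos (Real.sqrt_pos.2 hl) hε
        rw [EllipsoidProcess.f₂_eq hε.le, if_neg]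
        rw [not_le, Nat.lt_ceil]
        push_cast
        have : (N : ℝ) < ‖x - z‖ / (√lam * ε) := by
          rw [lt_div_iff₀ hs]
          linarith
        linarith
  exact ⟨Q, hQ, EllipsoidProcess.integrableOn_coupled h1 hα.1.le hε.le N u A x z Q, hlt⟩
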